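/- **Setting (labels by 1-NN).** Let $\mu,\mu_{\min}\in\mathbb R^d$, let $\Sigma\in\mathbb R^{d\times d}$ be symmetric positive definite, and assume $\mu_{\min}^\top\Sigma^{-1}\mu<0$. Majority points $(x,y)$ have $y$ uniform on $\{\pm1\}$ and $x\mid y\sim\mathcal N(y\mu,\Sigma)$; minority points have $y$ uniform on $\{\pm1\}$ and $x\mid y\sim\mathcal N(y\mu_{\min},I)$. For a matrix $P\in\mathbb R^{d\times d}$ let $\varepsilon_{\mathrm{lbl}}^{(n)}(P)$ be the probability that a fresh minority point $(x,y)$ is given a label different from $y$ by the 1-nearest-neighbour rule (Euclidean distance between representations $Px$ and $Px_i$, ties resolved by the smallest index) trained on $n+1$ i.i.d. majority points; the probability is over the training sample and the minority point. The raw features are the case $P=I$. **Setting (collective).** A binary classification problem has a base distribution $P_0$ on $\mathcal X\times\{\pm1\}$, with feature marginal and conditional label law $P_0(y\mid x)$, and a measurable idempotent map $g:\mathcal X\to\mathcal X$. Put $y^*(x)=b(g(x))$, where $b(x)\in\arg\max_yP_0(y\mid x)$ is a measurable selection. A collective of size $\alpha\in(0,1]$ keeps the features $x$, drawn from $P_0$,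 and reports the label $y^*(x)$ except that, at every $x$, the reported label is wrong with probability $e$; thus the training distribution has the feature marginal of $P_0$ and conditional label law $P_\alpha(y\mid x)=\alpha\bigl((1-e)\mathbf 1\{y=y^*(x)\}+e\,\mathbf 1\{y\ne y^*(x)\}\bigr)+(1-\alpha)P_0(y\mid x)$. A measurable classifier $f$ is $\epsilon$-suboptimal, $\epsilon\ge0$, if $f(x)\in\arg\max_yP'(y\mid x)$ for all $x$, for some conditional law $P'$ with $\mathrm{TV}(P_\alpha(\cdot\mid x),P'(\cdot\mid x))\le\epsilon$ for all $x$. The success is $S(f)=P_0[f(x)=f(g(x))]$. Let $\tau=\mathbb E_{x\sim P_0}\max_y[P_0(y\mid x)-P_0(y\mid g(x))]$ and $$B(e)=1-\frac{2(1-\alpha)}{(1-2e)\alpha}\,\tau-\frac{2\epsilon}{(1-2e)\alpha},\qquad G(e)=\begin{cases}\max(0,B(e)) & e<\tfrac12,\\ 0& e\ge\tfrac12,\end{cases}$$ so that $G(e)$ is the guarantee given by the success bound $B(e)$ where that bound applies ($e<\frac12$), and the trivial guarantee $0$ otherwise. **Statement.** There is an orthogonal projection matrix $P\in\mathbb R^{d\times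 d}$ ($P^2=P=P^\top$) such that the limits $\varepsilon_{\mathrm{rep}}=\lim_n\varepsilon_{\mathrm{lbl}}^{(n)}(P)$ and $\varepsilon_{\mathrm{raw}}=\lim_n\varepsilon_{\mathrm{lbl}}^{(n)}(I)$ exist and $$\varepsilon_{\mathrm{rep}}<\varepsilon_{\mathrm{raw}},\qquad \varepsilon_{\mathrm{rep}}\le\tfrac12<\varepsilon_{\mathrm{raw}},$$ with $\varepsilon_{\mathrm{rep}}<\frac12$ whenever $\mu,\mu_{\min}$ are linearly independent. Moreover, for every problem, $g$, $b$, $\alpha$ and $\epsilon$ as above: 1. $S(f)\ge G(e)$ for every $e\in[0,1]$ and every measurable $f$ that is $\epsilon$-suboptimal for the training distribution with label error $e$; 2. $G(\varepsilon_{\mathrm{raw}})\le G(\varepsilon_{\mathrm{rep}})$, with strict inequality if $2(1-\alpha)\tau+2\epsilon<(1-2\varepsilon_{\mathrm{rep}})\alpha$. Finally, there is $n_0$, independent of the problem, such that for all $n\ge n_0$ one has $\varepsilon_{\mathrm{lbl}}^{(n)}(P)<\varepsilon_{\mathrm{lbl}}^{(n)}(I)$, and 2. also holds with $\varepsilon_{\mathrm{lbl}}^{(n)}(P)$,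 $\varepsilon_{\mathrm{lbl}}^{(n)}(I)$ in place of $\varepsilon_{\mathrm{rep}}$, $\varepsilon_{\mathrm{raw}}$. -/

import Mathlib

open MeasureTheory ProbabilityTheory Filter Topology

universe u

namespace MinorityCollective

noncomputable section

/-! ### One-nearest-neighbour labelling

Labels are Booleans: `true` is the label `+1` and `false` is the label `-1`. -/

/-- The joint law of (features, label): the label is uniform on `±1`, and given the label `y` the
features are distributed as `N(y m, S)`. -/
def labelledGaussian {d : ℕ} (m : EuclideanSpace ℝ (Fin d)) (S : Matrix (Fin d) (Fin d) ℝ) :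
    Measure (EuclideanSpace ℝ (Fin d) × Bool) :=
  (2⁻¹ : ENNReal) • (multivariateGaussian m S).map (fun x => (x, true)) +
    (2⁻¹ : ENNReal) • (multivariateGaussian (-m) S).map (fun x => (x, false))

/-- The Euclidean distance of the representations `P x` and `P z`. -/
def repDist {d : ℕ} (P : Matrix (Fin d) (Fin d) ℝ) (x z : EuclideanSpace ℝ (Fin d)) : ℝ :=
  dist (Matrix.toEuclideanCLM (𝕜 := ℝ) P x) (Matrix.toEuclideanCLM (𝕜 := ℝ) P z)

open Classical in
/-- The indices of the samples whose representation is nearest to that of `x`. -/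
def nearest {d n : ℕ} (P : Matrix (Fin d) (Fin d) ℝ)
    (D : Fin (n + 1) → EuclideanSpace ℝ (Fin d) × Bool) (x : EuclideanSpace ℝ (Fin d)) :
    Finset (Fin (n + 1)) :=
  Finset.univ.filter fun i => ∀ j, repDist P (D i).1 x ≤ repDist P (D j).1 x

theorem nearest_nonempty {d n : ℕ} (P : Matrix (Fin d) (Fin d) ℝ)
    (D : Fin (n + 1) → EuclideanSpace ℝ (Fin d) × Bool) (x : EuclideanSpace ℝ (Fin d)) :
    (nearest P D x).Nonempty := by
  obtain ⟨i, -, hi⟩ := Finset.exists_min_image (Finset.univ : Finset (Fin (n + 1)))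
    (fun i => repDist P (D i).1 x) Finset.univ_nonempty
  exact ⟨i, by simpa [nearest] using hi⟩

/-- The 1-NN label of `x`: the label of the sample whose representation is nearest to that of `x`
(the first such sample in case of ties). -/
def nnLabel {d n : ℕ} (P : Matrix (Fin d) (Fin d) ℝ)
    (D : Fin (n + 1) → EuclideanSpace ℝ (Fin d) × Bool) (x : EuclideanSpace ℝ (Fin d)) : Bool :=
  (D ((nearest P D x).min' (nearest_nonempty P D x))).2

/-- The label error of 1-NN on the representation `x ↦ P x`: the probability that the 1-NN label
of a fresh minority point, whose law is `labelledGaussian μmin Smin`, differs from its label, when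
1-NN uses `n + 1` i.i.d. majority samples from `labelledGaussian μ S`.
The raw features are the case `P = 1`. -/
def labelError {d : ℕ} (μ : EuclideanSpace ℝ (Fin d)) (S : Matrix (Fin d) (Fin d) ℝ)
    (μmin : EuclideanSpace ℝ (Fin d)) (Smin : Matrix (Fin d) (Fin d) ℝ)
    (P : Matrix (Fin d) (Fin d) ℝ) (n : ℕ) : ℝ :=
  ((Measure.pi fun _ : Fin (n + 1) => labelledGaussian μ S).prod
      (labelledGaussian μmin Smin)).real
    {ω | nnLabel P ω.1 ω.2.1 ≠ ω.2.2}

/-! ### Collective action with erroneous labels -/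

/-- Total variation distance. -/
def tvDist {Ω : Type*} [MeasurableSpace Ω] (P Q : Measure Ω) : ℝ :=
  ⨆ E : {E : Set Ω // MeasurableSet E}, |P.real E - Q.real E|

/-- A classifier `f` is `ε`-suboptimal on the set `A` for a distribution with conditional label
law `κ` if it is the Bayes classifier on `A` of some conditional label law within total variation
distance `ε` of `κ`. -/
def IsSuboptimal {X : Type*} [MeasurableSpace X] (ε : ℝ) (A : Set X) (κ : Kernel X Bool)
    (f : X → Bool) : Prop :=
  ∃ κ' : Kernel X Bool, IsMarkovKernel κ' ∧ (∀ x, tvDist (κ x) (κ' x) ≤ ε) ∧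
    ∀ x ∈ A, ∀ y, (κ' x).real {y} ≤ (κ' x).real {f x}

/-- The conditional label law that at `x` is the mixture `(1 - t) κ x + t κ' x`. -/
def mixKernel {X : Type*} [MeasurableSpace X] (t : ℝ) (κ κ' : Kernel X Bool) : Kernel X Bool where
  toFun x := ENNReal.ofReal (1 - t) • κ x + ENNReal.ofReal t • κ' x
  measurable' := by
    refine Measure.measurable_of_measurable_coe _ fun s hs => ?_
    simp only [Measure.coe_add, Measure.coe_smul, Pi.add_apply, Pi.smul_apply, smul_eq_mul]
    exact ((κ.measurable_coe hs).const_mul _).add ((κ'.measurable_coe hs).const_mul _)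

instance {X : Type*} [MeasurableSpace X] (t : ℝ) (κ κ' : Kernel X Bool) [IsFiniteKernel κ]
    [IsFiniteKernel κ'] : IsFiniteKernel (mixKernel t κ κ') :=
  ⟨⟨ENNReal.ofReal (1 - t) * κ.bound + ENNReal.ofReal t * κ'.bound,
    ENNReal.add_lt_top.2 ⟨ENNReal.mul_lt_top (by simp) κ.bound_lt_top,
      ENNReal.mul_lt_top (by simp) κ'.bound_lt_top⟩, fun x => by
    simp only [mixKernel, Kernel.coe_mk, Measure.coe_add, Measure.coe_smul, Pi.add_apply,
      Pi.smul_apply, smul_eq_mul]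
    gcongr <;> exact Kernel.measure_le_bound _ _ _⟩⟩

/-- A collective that uses the signal-erasure strategy in binary classification. The base
distribution `P₀` is given by its feature marginal and its conditional label law. -/
structure Collective (X : Type*) [MeasurableSpace X] where
  /-- The feature marginal of `P₀`. -/
  marginal : Measure X
  isProbability : IsProbabilityMeasure marginal
  /-- The conditional label law `P₀(y | x)`. -/
  cond : Kernel X Bool
  isMarkov : IsMarkovKernel cond
  /-- The map that erases the signal. -/
  g : X → X
  measurable_g : Measurable g
  idempotent_g : ∀ x, g (g x) = g x
  /-- The Bayes classifier `x ↦ argmax_y P₀(y | x)`, with any rule for breaking ties. -/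
  bayes : X → Bool
  measurable_bayes : Measurable bayes
  isArgmax_bayes : ∀ x y, (cond x).real {y} ≤ (cond x).real {bayes x}
  /-- The size of the collective, as a fraction of the training data. -/
  α : ℝ
  α_pos : 0 < α
  α_le_one : α ≤ 1

namespace Collective

variable {X : Type*} [MeasurableSpace X] (C : Collective X)

/-- The label `y⋆(x) = argmax_y P₀(y | g(x))` that the strategy asks for. -/
def target (x : X) : Bool := C.bayes (C.g x)

theorem measurable_target : Measurable C.target := C.measurable_bayes.comp C.measurable_g

/-- The conditional law of the labels that the collective reports when each of them is wrong with
probability `e`. -/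
def reported (e : ℝ) : Kernel X Bool :=
  mixKernel e (Kernel.deterministic C.target C.measurable_target)
    (Kernel.deterministic (fun x => !C.target x)
      ((measurable_of_countable not).comp C.measurable_target))

/-- The conditional label law of the training distribution `P_α = α P⋆ + (1 - α) P₀`, where `P⋆`
is the law of a feature vector drawn from `P₀` together with its reported label. -/
def train (e : ℝ) : Kernel X Bool := mixKernel C.α C.cond (C.reported e)

/-- `train` is the conditional label law of the mixture of the joint laws. -/
theorem compProd_train (e : ℝ) :
    C.marginal.compProd (C.train e) =
      ENNReal.ofReal C.α • C.marginal.compProd (C.reported e) +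
        ENNReal.ofReal (1 - C.α) • C.marginal.compProd C.cond := by
  have := C.isProbability
  have := C.isMarkov
  have : IsFiniteKernel (C.reported e) := by unfold reported; infer_instance
  have : IsFiniteKernel (C.train e) := by unfold train; infer_instance
  ext s hs
  simp only [Measure.coe_add, Measure.coe_smul, Pi.add_apply, Pi.smul_apply, smul_eq_mul]
  rw [Measure.compProd_apply hs, Measure.compProd_apply hs, Measure.compProd_apply hs,
    ← lintegral_const_mul _ (Kernel.measurable_kernel_prodMk_left hs),
    ← lintegral_const_mul _ (Kernel.measurable_kernel_prodMk_left hs),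
    ← lintegral_add_left ((Kernel.measurable_kernel_prodMk_left hs).const_mul _)]
  refine lintegral_congr fun x => ?_
  simp [train, mixKernel, add_comm]

/-- `τ = E_{x ∼ P₀} max_y [P₀(y | x) - P₀(y | g(x))]`. -/
def tau : ℝ :=
  ∫ x, max ((C.cond x).real {true} - (C.cond (C.g x)).real {true})
    ((C.cond x).real {false} - (C.cond (C.g x)).real {false}) ∂C.marginal

/-- The success `S(α) = P₀[f(x) = f(g(x))]` of the collective against the classifier `f`. -/
def success (f : X → Bool) : ℝ := C.marginal.real {x | f x = f (C.g x)}

/-- The expression in the success bound for label error `e` and classifier suboptimality `ε`. -/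
def bound (ε e : ℝ) : ℝ :=
  1 - 2 * (1 - C.α) / ((1 - 2 * e) * C.α) * C.tau - 2 * ε / ((1 - 2 * e) * C.α)

/-- The guarantee on the success: the success bound where it applies, that is for `e < 1 / 2`,
and the trivial guarantee `0` otherwise or where the success bound is negative. -/
def guarantee (ε e : ℝ) : ℝ := if e < 1 / 2 then max 0 (C.bound ε e) else 0

end Collective

end

end MinorityCollective

/-! ### The success bound under label error -/

namespace MinorityCollective

section Success

/-! The argument has a nearest-neighbour half and a collective half, joined by the threshold `1 /
2`.

As the sample grows, the nearest representation converges to that of the query, so the 1-NN label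
behaves like a draw from the conditional label law there (`tendsto_measure_nearest_mem`,
`tendsto_labelError`). The log-likelihood ratio of the two majority classes is linear, `2⟪w, x⟫`, so
this law is `sigmoid (2⟪w, x⟫)` and the limiting error is the mean of `sigmoid (-2⟪w, x⟫)` under
`N(μmin, I)`. It would be `1 / 2` under `N(0, I)` by symmetry; the shift by `μmin` pushes it below
or above according to the sign of `⟪w, μmin⟫`. For raw features `w = S⁻¹ μ`, and the sign is
negative by hypothesis. For the projection onto a unit vector `u`, `w` is `⟪u, μ⟫ / uᵀSu` times `u`,
and the bisector of `μ` and `μmin` makes the sign positive when they are independent. Otherwise the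
zero projection gives exactly `1 / 2`.

For the collective, a wrong prediction at `x` requires a large gap between the label laws at `x` and
`g x`, and Markov's inequality bounds how often this happens (`guarantee_le_success`). The resulting
guarantee decreases in the label error and vanishes above `1 / 2`, which is where the raw error
lies. -/

theorem abs_real_sub_le_tvDist {Ω : Type*} [MeasurableSpace Ω] (P Q : Measure Ω)
    [IsFiniteMeasure P] [IsFiniteMeasure Q] {E : Set Ω} (hE : MeasurableSet E) :
    |P.real E - Q.real E| ≤ tvDist P Q := by
  -- Boundedness has to be supplied: an unbounded real supremum would default to 0.
  refine le_ciSup (f := fun E : {E : Set Ω // MeasurableSet E} => |P.real E - Q.real E|)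
    ⟨P.real Set.univ + Q.real Set.univ, ?_⟩ ⟨E, hE⟩
  rintro _ ⟨E, rfl⟩
  have h1 : P.real E ≤ P.real Set.univ := measureReal_mono (Set.subset_univ _)
  have h2 : Q.real E ≤ Q.real Set.univ := measureReal_mono (Set.subset_univ _)
  have h3 : 0 ≤ P.real E := measureReal_nonneg
  have h4 : 0 ≤ Q.real E := measureReal_nonneg
  rw [abs_le]
  constructor <;> linarith

theorem mixKernel_real {X : Type*} [MeasurableSpace X] {t : ℝ} (h0 : 0 ≤ t) (h1 : t ≤ 1)
    (κ κ' : Kernel X Bool) [IsFiniteKernel κ] [IsFiniteKernel κ'] (x : X) (s : Set Bool) :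
    (mixKernel t κ κ' x).real s = (1 - t) * (κ x).real s + t * (κ' x).real s := by
  have : mixKernel t κ κ' x = ENNReal.ofReal (1 - t) • κ x + ENNReal.ofReal t • κ' x := rfl
  have h2 : (ENNReal.ofReal (1 - t) • κ x) s ≠ ⊤ := by
    simpa using ENNReal.mul_ne_top ENNReal.ofReal_ne_top (measure_ne_top (κ x) s)
  have h3 : (ENNReal.ofReal t • κ' x) s ≠ ⊤ := by
    simpa using ENNReal.mul_ne_top ENNReal.ofReal_ne_top (measure_ne_top (κ' x) s)
  rw [this, measureReal_add_apply h2 h3, measureReal_ennreal_smul_apply,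
    measureReal_ennreal_smul_apply, ENNReal.toReal_ofReal (by linarith), ENNReal.toReal_ofReal h0]

theorem real_true_add_real_false (P : Measure Bool) [IsProbabilityMeasure P] :
    P.real {true} + P.real {false} = 1 := by
  rw [← measureReal_union (by simp) (by simp), ← probReal_univ (μ := P)]
  congr 1
  ext b
  cases b <;> simp

namespace Collective

variable {X : Type*} [MeasurableSpace X] (C : Collective X)

theorem train_real {e : ℝ} (he : e ∈ Set.Icc (0 : ℝ) 1) (x : X) :
    (C.train e x).real {C.target x} = (1 - C.α) * (C.cond x).real {C.target x} + C.α * (1 - e) ∧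
    (C.train e x).real {!C.target x} = (1 - C.α) * (C.cond x).real {!C.target x} + C.α * e := by
  have := C.isMarkov
  have : IsFiniteKernel (C.reported e) := by unfold reported; infer_instance
  constructor
  · rw [train, mixKernel_real C.α_pos.le C.α_le_one, reported, mixKernel_real he.1 he.2]
    simp [Kernel.deterministic_apply, measureReal_def]
  · rw [train, mixKernel_real C.α_pos.le C.α_le_one, reported, mixKernel_real he.1 he.2]
    simp [Kernel.deterministic_apply, measureReal_def]

/-- The integrand `max_y [P₀(y | x) - P₀(y | g(x))]` of `τ`. -/
noncomputable def gap (x : X) : ℝ :=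
  max ((C.cond x).real {true} - (C.cond (C.g x)).real {true})
    ((C.cond x).real {false} - (C.cond (C.g x)).real {false})

theorem measurable_cond_real (y : Bool) : Measurable fun x => (C.cond x).real {y} :=
  (C.cond.measurable_coe (measurableSet_singleton y)).ennreal_toReal

theorem measurable_gap : Measurable C.gap :=
  ((C.measurable_cond_real true).sub ((C.measurable_cond_real true).comp C.measurable_g)).max
    ((C.measurable_cond_real false).sub ((C.measurable_cond_real false).comp C.measurable_g))

/-- The two entries of the maximum sum to zero, both laws having total mass one. -/
theorem gap_nonneg (x : X) : 0 ≤ C.gap x := by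
  have := C.isMarkov
  have h1 := real_true_add_real_false (C.cond x)
  have h2 := real_true_add_real_false (C.cond (C.g x))
  rw [gap, le_max_iff]
  by_contra! h
  linarith [h.1, h.2]

theorem gap_le_one (x : X) : C.gap x ≤ 1 := by
  have := C.isMarkov
  refine max_le ?_ ?_
  · linarith [measureReal_nonneg (μ := C.cond (C.g x)) (s := {true}),
      measureReal_le_one (μ := C.cond x) (s := {true})]
  · linarith [measureReal_nonneg (μ := C.cond (C.g x)) (s := {false}),
      measureReal_le_one (μ := C.cond x) (s := {false})]

theorem integrable_gap : Integrable C.gap C.marginal := by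
  have := C.isProbability
  refine Integrable.of_bound C.measurable_gap.aestronglyMeasurable 1 (ae_of_all _ fun x => ?_)
  rw [Real.norm_of_nonneg (C.gap_nonneg x)]
  exact C.gap_le_one x

theorem tau_nonneg : 0 ≤ C.tau := integral_nonneg C.gap_nonneg

theorem gap_g (x : X) : C.gap (C.g x) = 0 := by simp [gap, C.idempotent_g]

theorem target_g (x : X) : C.target (C.g x) = C.target x := by simp [target, C.idempotent_g]

/-- At `g x` the target is a Bayes label, so the difference there is at most zero. Moving from `g x`
to `x` raises one probability and lowers the other by at most the gap each, whence the factor 2. -/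
theorem cond_target_sub (x : X) :
    (C.cond x).real {!C.target x} - (C.cond x).real {C.target x} ≤ 2 * C.gap x := by
  have := C.isMarkov
  have h1 := real_true_add_real_false (C.cond x)
  have h2 := real_true_add_real_false (C.cond (C.g x))
  have h3 := C.isArgmax_bayes (C.g x) (!C.target x)
  change _ ≤ (C.cond (C.g x)).real {C.target x} at h3
  have h4 := le_max_left ((C.cond x).real {true} - (C.cond (C.g x)).real {true})
    ((C.cond x).real {false} - (C.cond (C.g x)).real {false})
  have h5 := le_max_right ((C.cond x).real {true} - (C.cond (C.g x)).real {true})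
    ((C.cond x).real {false} - (C.cond (C.g x)).real {false})
  unfold gap
  cases h : C.target x <;> simp only [h, Bool.not_true, Bool.not_false] at h3 ⊢ <;> linarith

/-- An `ε`-suboptimal classifier predicts the target label wherever the base distribution is
close enough to its erased version. -/
theorem le_gap_of_ne_target {ε e : ℝ} (he : e ∈ Set.Icc (0 : ℝ) 1) {f : X → Bool}
    (hf : IsSuboptimal ε Set.univ (C.train e) f) {x : X} (hx : f x ≠ C.target x) :
    C.α * (1 - 2 * e) ≤ 2 * (1 - C.α) * C.gap x + 2 * ε := by
  have := C.isMarkov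
  have : IsFiniteKernel (C.reported e) := by unfold reported; infer_instance
  have : IsFiniteKernel (C.train e) := by unfold train; infer_instance
  obtain ⟨κ, hκ, htv, hmax⟩ := hf
  have hfx : f x = !C.target x := by
    cases h : f x <;> cases h' : C.target x <;> simp_all
  -- The nearby law `κ` ranks the wrong label at least as high as the target. Passing back to
  -- `train` costs `ε` for each of the two labels, hence `2 * ε`.
  have h1 := hmax x (Set.mem_univ _) (C.target x)
  rw [hfx] at h1
  have h2 := abs_le.1 ((abs_real_sub_le_tvDist (C.train e x) (κ x)
    (measurableSet_singleton (C.target x))).trans (htv x))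
  have h3 := abs_le.1 ((abs_real_sub_le_tvDist (C.train e x) (κ x)
    (measurableSet_singleton (!C.target x))).trans (htv x))
  obtain ⟨h4, h5⟩ := C.train_real he x
  have h6 := mul_le_mul_of_nonneg_left (C.cond_target_sub x) (sub_nonneg.2 C.α_le_one)
  rw [h4] at h2
  rw [h5] at h3
  linarith [h2.2, h3.1]

theorem guarantee_nonneg (ε e : ℝ) : 0 ≤ C.guarantee ε e := by
  unfold guarantee
  split_ifs
  · exact le_max_left _ _
  · exact le_rfl

theorem bound_eq (ε : ℝ) {e : ℝ} (he : e < 1 / 2) :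
    C.bound ε e = 1 - (2 * (1 - C.α) * C.tau + 2 * ε) / ((1 - 2 * e) * C.α) := by
  have h1 : 0 < (1 - 2 * e) * C.α := mul_pos (by linarith) C.α_pos
  rw [bound]
  field_simp
  ring

/-- Once `f` is known to hit the target at every `g x`, a disagreement between `f x` and `f (g x)`
is a missed target at `x`, so the gap there is large. Its mean is `τ`, and Markov's inequality
applies. -/
theorem guarantee_le_success {ε e : ℝ} (hε : 0 ≤ ε) (he : e ∈ Set.Icc (0 : ℝ) 1) {f : X → Bool}
    (hfm : Measurable f) (hf : IsSuboptimal ε Set.univ (C.train e) f) :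
    C.guarantee ε e ≤ C.success f := by
  have := C.isProbability
  unfold guarantee
  split_ifs with h
  swap
  · exact measureReal_nonneg
  refine max_le measureReal_nonneg ?_
  have hc : 0 < (1 - 2 * e) * C.α := mul_pos (by linarith) C.α_pos
  have hα := C.α_le_one
  have hτ := C.tau_nonneg
  rw [C.bound_eq ε h]
  -- If the suboptimality swamps the collective's margin, the bound is nonpositive and nothing is to
  -- be shown.
  by_cases hsmall : (1 - 2 * e) * C.α ≤ 2 * ε
  · have : 1 ≤ (2 * (1 - C.α) * C.tau + 2 * ε) / ((1 - 2 * e) * C.α) := by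
      rw [le_div_iff₀ hc]
      nlinarith [mul_nonneg (sub_nonneg.2 hα) hτ]
    linarith [measureReal_nonneg (μ := C.marginal) (s := {x | f x = f (C.g x)}),
      show C.success f = C.marginal.real {x | f x = f (C.g x)} from rfl]
  -- The gap vanishes at `g x` by idempotence, so a missed target there would contradict the
  -- negation of `hsmall`.
  have hg : ∀ x, f (C.g x) = C.target x := by
    intro x
    by_contra hx
    rw [← C.target_g] at hx
    have := C.le_gap_of_ne_target he hf hx
    rw [C.gap_g] at this
    linarith
  have hms : MeasurableSet {x | f x = f (C.g x)} :=
    measurableSet_eq_fun hfm (hfm.comp C.measurable_g)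
  have hsub : {x | f x = f (C.g x)}ᶜ ⊆
      {x | (1 - 2 * e) * C.α ≤ 2 * (1 - C.α) * C.gap x + 2 * ε} := by
    intro x hx
    have hx' : f x ≠ C.target x := by rw [← hg]; exact hx
    have := C.le_gap_of_ne_target he hf hx'
    simp only [Set.mem_ofPred_eq]
    linarith
  have hmarkov := mul_meas_ge_le_integral_of_nonneg (μ := C.marginal)
    (f := fun x => 2 * (1 - C.α) * C.gap x + 2 * ε)
    (ae_of_all _ fun x => by
      have := mul_nonneg (sub_nonneg.2 hα) (C.gap_nonneg x)
      simp only [Pi.zero_apply]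
      linarith)
    ((C.integrable_gap.const_mul _).add (integrable_const _)) ((1 - 2 * e) * C.α)
  rw [integral_add (C.integrable_gap.const_mul _) (integrable_const _), integral_const_mul,
    integral_const, probReal_univ, one_smul] at hmarkov
  have hcompl : C.marginal.real {x | f x = f (C.g x)}ᶜ ≤
      (2 * (1 - C.α) * C.tau + 2 * ε) / ((1 - 2 * e) * C.α) := by
    rw [le_div_iff₀ hc, mul_comm]
    exact (mul_le_mul_of_nonneg_left (measureReal_mono hsub) hc.le).trans hmarkov
  rw [probReal_compl_eq_one_sub hms] at hcompl
  change _ ≤ C.marginal.real {x | f x = f (C.g x)}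
  linarith

theorem guarantee_antitone {ε : ℝ} (hε : 0 ≤ ε) : Antitone (C.guarantee ε) := by
  intro a b hab
  by_cases hb : b < 1 / 2
  · have ha : a < 1 / 2 := hab.trans_lt hb
    have hN : 0 ≤ 2 * (1 - C.α) * C.tau + 2 * ε := by
      have := mul_nonneg (sub_nonneg.2 C.α_le_one) C.tau_nonneg
      linarith
    rw [guarantee, guarantee, if_pos ha, if_pos hb, C.bound_eq ε ha, C.bound_eq ε hb]
    have hc : 0 < (1 - 2 * b) * C.α := mul_pos (by linarith) C.α_pos
    have hc' : (1 - 2 * b) * C.α ≤ (1 - 2 * a) * C.α :=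
      mul_le_mul_of_nonneg_right (by linarith) C.α_pos.le
    gcongr
  · rw [guarantee, if_neg hb]
    exact C.guarantee_nonneg ε a

/-- The hypothesis `h` says that the bound at `a` is positive, and it forces `a < 1 / 2` because its
left side is nonnegative. The guarantee at `b` is the trivial one. -/
theorem guarantee_lt_guarantee {ε a b : ℝ} (hε : 0 ≤ ε) (hb : 1 / 2 < b)
    (h : 2 * (1 - C.α) * C.tau + 2 * ε < (1 - 2 * a) * C.α) :
    C.guarantee ε b < C.guarantee ε a := by
  have hN : 0 ≤ 2 * (1 - C.α) * C.tau + 2 * ε := by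
    have := mul_nonneg (sub_nonneg.2 C.α_le_one) C.tau_nonneg
    linarith
  have hc : 0 < (1 - 2 * a) * C.α := hN.trans_lt h
  have ha : a < 1 / 2 := by
    have := (pos_iff_pos_of_mul_pos hc).2 C.α_pos
    linarith
  rw [guarantee, if_neg (by linarith), guarantee, if_pos ha, C.bound_eq ε ha, lt_max_iff]
  right
  rw [sub_pos, div_lt_one hc]
  exact h

end Collective

end Success

end MinorityCollective

/-! ### Asymptotics of the nearest-neighbour label -/

namespace MinorityCollective

section NearestNeighbour

open Classical in
/-- The first index at which `r` is minimal. -/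
noncomputable def firstMin {n : ℕ} (r : Fin (n + 1) → ℝ) : Fin (n + 1) :=
  (Finset.univ.filter fun i => ∀ j, r i ≤ r j).min' (by
    obtain ⟨i, -, hi⟩ := Finset.exists_min_image Finset.univ r Finset.univ_nonempty
    exact ⟨i, by simpa using hi⟩)

theorem firstMin_le {n : ℕ} (r : Fin (n + 1) → ℝ) (j : Fin (n + 1)) : r (firstMin r) ≤ r j := by
  classical
  have h := Finset.min'_mem (Finset.univ.filter fun i => ∀ j, r i ≤ r j) (by
    obtain ⟨i, -, hi⟩ := Finset.exists_min_image Finset.univ r Finset.univ_nonempty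
    exact ⟨i, by simpa using hi⟩)
  have h' := (Finset.mem_filter.1 h).2 j
  unfold firstMin
  convert h'

/-- Expressing the tie-breaking rule by finitely many inequalities makes it measurable. -/
theorem firstMin_eq_iff {n : ℕ} (r : Fin (n + 1) → ℝ) (i : Fin (n + 1)) :
    firstMin r = i ↔ ∀ j, r i ≤ r j ∧ (j < i → r i < r j) := by
  classical
  have hmin : ∀ k, (∀ j, r k ≤ r j) → firstMin r ≤ k := fun k hk =>
    Finset.min'_le _ _ (by simpa using hk)
  constructor
  · rintro rfl j
    refine ⟨firstMin_le r j, fun hj => lt_of_not_ge fun hle => ?_⟩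
    exact absurd (hmin j fun k => hle.trans (firstMin_le r k)) (not_le.2 hj)
  · intro h
    refine le_antisymm (hmin i fun j => (h j).1) (not_lt.1 fun hlt => ?_)
    exact absurd ((h _).2 hlt) (not_lt.2 (firstMin_le r i))

theorem measurable_firstMin {n : ℕ} : Measurable (firstMin (n := n)) := by
  refine measurable_to_countable' fun i => ?_
  have : firstMin ⁻¹' {i} = ⋂ j, ({r : Fin (n + 1) → ℝ | r i ≤ r j} ∩
      {r : Fin (n + 1) → ℝ | j < i → r i < r j}) := by
    ext r
    simp [firstMin_eq_iff]
  rw [this]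
  refine MeasurableSet.iInter fun j => (measurableSet_le (by fun_prop) (by fun_prop)).inter ?_
  by_cases h : j < i
  · simpa [h] using measurableSet_lt (measurable_pi_apply i) (measurable_pi_apply j)
  · simp [h]

variable {α : Type*} [MeasurableSpace α] {ρ : Measure α} [IsProbabilityMeasure ρ]

theorem measurable_firstMin_comp {n : ℕ} {r : α → ℝ} (hr : Measurable r) :
    Measurable fun D : Fin (n + 1) → α => firstMin fun i => r (D i) :=
  measurable_firstMin.comp (measurable_pi_lambda _ fun i => hr.comp (measurable_pi_apply i))

/-- If `η` is the conditional probability of `L` given `r`, then, on the event that the sample `i`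
is the nearest one, `η` is the conditional probability that this sample belongs to `L`. -/
theorem measure_firstMin_eq_inter {r : α → ℝ} (hr : Measurable r) {L : Set α}
    (hL : MeasurableSet L) {η : α → ENNReal} (hη : Measurable η)
    (hdis : ∀ B : Set ℝ, MeasurableSet B → ρ (r ⁻¹' B ∩ L) = ∫⁻ z in r ⁻¹' B, η z ∂ρ)
    (n : ℕ) (i : Fin (n + 1)) :
    (Measure.pi fun _ : Fin (n + 1) => ρ) {D | (firstMin fun j => r (D j)) = i ∧ D i ∈ L} =
      ∫⁻ D in {D | (firstMin fun j => r (D j)) = i}, η (D i)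
        ∂(Measure.pi fun _ : Fin (n + 1) => ρ) := by
  -- Sample `i` is split off from the others, so that Fubini allows conditioning on the latter.
  have hmp := (measurePreserving_piFinSuccAbove (fun _ : Fin (n + 1) => ρ) i).symm
  have hA : MeasurableSet {D : Fin (n + 1) → α | (firstMin fun j => r (D j)) = i} :=
    measurable_firstMin_comp hr (measurableSet_singleton i)
  have hAL : MeasurableSet
      {D : Fin (n + 1) → α | (firstMin fun j => r (D j)) = i ∧ D i ∈ L} :=
    hA.inter (measurable_pi_apply i hL)
  have hm : Measurable ({D : Fin (n + 1) → α | (firstMin fun j => r (D j)) = i}.indicator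
      fun D => η (D i)) := (hη.comp (measurable_pi_apply i)).indicator hA
  have hB : ∀ D' : Fin n → α,
      MeasurableSet {t : ℝ | firstMin (i.insertNth t fun j => r (D' j)) = i} := fun D' =>
    (measurable_firstMin.comp (by fun_prop)) (measurableSet_singleton i)
  have key : ∀ (z : α) (D' : Fin n → α),
      (fun j => r ((i.insertNth z D' : Fin (n + 1) → α) j)) =
        (i.insertNth (r z) fun j => r (D' j) : Fin (n + 1) → ℝ) := by
    intro z D'
    funext j
    refine Fin.succAboveCases i ?_ (fun k => ?_) j <;> simp
  rw [← lintegral_indicator hA, ← hmp.measure_preimage hAL.nullMeasurableSet,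
    ← hmp.lintegral_comp hm,
    Measure.prod_apply_symm (hmp.measurable hAL), lintegral_prod_symm']
  swap
  · exact hm.comp hmp.measurable
  refine lintegral_congr fun D' => ?_
  -- With the other samples fixed, whether `i` is nearest depends on its value `z` only through `r
  -- z`; this is why `hdis` is needed only for preimages under `r`.
  have e1 : (fun z => (z, D')) ⁻¹' ((MeasurableEquiv.piFinSuccAbove (fun _ => α) i).symm ⁻¹'
      {D | (firstMin fun j => r (D j)) = i ∧ D i ∈ L}) =
      r ⁻¹' {t : ℝ | firstMin (i.insertNth t fun j => r (D' j)) = i} ∩ L := by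
    ext z
    simp [MeasurableEquiv.piFinSuccAbove_symm_apply, Fin.insertNthEquiv, key]
  rw [e1, hdis _ (hB D'), ← lintegral_indicator (hr (hB D'))]
  refine lintegral_congr fun z => ?_
  simp [MeasurableEquiv.piFinSuccAbove_symm_apply, Fin.insertNthEquiv, key, Set.indicator_apply]

/-- The nearest sample belongs to `L` with a probability that converges to the conditional
probability of `L` at the query point. -/
theorem tendsto_measure_nearest_mem {r : α → ℝ} (hr : Measurable r) {L : Set α}
    (hL : MeasurableSet L) {η : α → ℝ} (hη : Measurable η) (hη0 : ∀ z, 0 ≤ η z)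
    (hη1 : ∀ z, η z ≤ 1)
    (hdis : ∀ B : Set ℝ, MeasurableSet B →
      ρ (r ⁻¹' B ∩ L) = ∫⁻ z in r ⁻¹' B, ENNReal.ofReal (η z) ∂ρ)
    {c : ℝ} (hc : c ∈ Set.Icc (0 : ℝ) 1)
    (hcont : ∀ δ > 0, ∃ s > 0, ∀ z, r z < s → |η z - c| ≤ δ)
    (hpos : ∀ s > 0, 0 < ρ {z | r z < s}) :
    Tendsto (fun n : ℕ => (Measure.pi fun _ : Fin (n + 1) => ρ).real
      {D | D (firstMin fun j => r (D j)) ∈ L}) atTop (𝓝 c) := by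
  have hT : ∀ n : ℕ, Measurable fun D : Fin (n + 1) → α => D (firstMin fun j => r (D j)) := by
    intro n
    have : Measurable fun p : Fin (n + 1) × (Fin (n + 1) → α) => p.2 p.1 :=
      measurable_from_prod_countable_right fun i => measurable_pi_apply i
    exact this.comp ((measurable_firstMin_comp hr).prodMk measurable_id)
  have hint : ∀ n : ℕ, Integrable (fun D : Fin (n + 1) → α => η (D (firstMin fun j => r (D j))))
      (Measure.pi fun _ : Fin (n + 1) => ρ) := by
    intro n
    refine Integrable.of_bound (hη.comp (hT n)).aestronglyMeasurable 1 (ae_of_all _ fun D => ?_)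
    rw [Real.norm_of_nonneg (hη0 _)]
    exact hη1 _
  -- Summing over the index of the nearest sample replaces membership in `L` by its conditional
  -- probability.
  have heq : ∀ n : ℕ, (Measure.pi fun _ : Fin (n + 1) => ρ).real
      {D | D (firstMin fun j => r (D j)) ∈ L} =
      ∫ D, η (D (firstMin fun j => r (D j))) ∂(Measure.pi fun _ : Fin (n + 1) => ρ) := by
    intro n
    rw [integral_eq_lintegral_of_nonneg_ae (ae_of_all _ fun _ => hη0 _)
      (hint n).aestronglyMeasurable, measureReal_def]
    congr 1
    have hA : ∀ i, MeasurableSet {D : Fin (n + 1) → α | (firstMin fun j => r (D j)) = i} :=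
      fun i => measurable_firstMin_comp hr (measurableSet_singleton i)
    have hdisj : Pairwise (Function.onFun Disjoint
        fun i => {D : Fin (n + 1) → α | (firstMin fun j => r (D j)) = i}) := by
      intro i j hij
      refine Set.disjoint_left.2 fun D hi hj => hij ?_
      exact hi.symm.trans hj
    have hU : ⋃ i, {D : Fin (n + 1) → α | (firstMin fun j => r (D j)) = i} = Set.univ := by
      ext D
      simp
    have hset : {D : Fin (n + 1) → α | D (firstMin fun j => r (D j)) ∈ L} =
        ⋃ i, {D | (firstMin fun j => r (D j)) = i ∧ D i ∈ L} := by
      ext D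
      simp
    have hAL : ∀ i, MeasurableSet
        {D : Fin (n + 1) → α | (firstMin fun j => r (D j)) = i ∧ D i ∈ L} :=
      fun i => (hA i).inter (measurable_pi_apply i hL)
    rw [hset, measure_iUnion (fun i j hij => (hdisj hij).mono (fun _ h => h.1) fun _ h => h.1)
      hAL, ← setLIntegral_univ, ← hU,
      lintegral_iUnion hA hdisj]
    refine tsum_congr fun i => ?_
    rw [measure_firstMin_eq_inter hr hL hη.ennreal_ofReal hdis]
    refine setLIntegral_congr_fun (hA i) fun D hD => ?_
    simp only [Set.mem_ofPred_eq] at hD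
    simp only [hD]
  rw [Metric.tendsto_atTop]
  intro δ hδ
  obtain ⟨s, hs, hsδ⟩ := hcont (δ / 2) (by positivity)
  -- A nearest sample at distance at least `s` means that all samples are that far, which has
  -- probability `q ^ (n + 1)` with `q < 1`. Closer than `s`, `η` is within `δ / 2` of `c`.
  have hq : ρ.real {z | s ≤ r z} < 1 := by
    have hm : MeasurableSet {z | r z < s} := measurableSet_lt hr measurable_const
    have : {z | s ≤ r z} = {z | r z < s}ᶜ := by ext; simp
    rw [this, probReal_compl_eq_one_sub hm]
    have : 0 < ρ.real {z | r z < s} := ENNReal.toReal_pos (hpos s hs).ne' (measure_ne_top _ _)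
    linarith
  have hlim : Tendsto (fun n : ℕ => ρ.real {z | s ≤ r z} ^ (n + 1)) atTop (𝓝 0) :=
    (tendsto_pow_atTop_nhds_zero_of_lt_one measureReal_nonneg hq).comp (tendsto_add_atTop_nat 1)
  obtain ⟨N, hN⟩ := eventually_atTop.1 (hlim.eventually (gt_mem_nhds (half_pos hδ)))
  refine ⟨N, fun n hn => ?_⟩
  set π := Measure.pi fun _ : Fin (n + 1) => ρ
  have hS : MeasurableSet {D : Fin (n + 1) → α | s ≤ r (D (firstMin fun j => r (D j)))} :=
    measurableSet_le measurable_const (hr.comp (hT n))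
  have hSle : π.real {D : Fin (n + 1) → α | s ≤ r (D (firstMin fun j => r (D j)))} ≤
      ρ.real {z | s ≤ r z} ^ (n + 1) := by
    have hsub : {D : Fin (n + 1) → α | s ≤ r (D (firstMin fun j => r (D j)))} ⊆
        Set.univ.pi fun _ => {z | s ≤ r z} := fun D hD i _ =>
      le_trans hD (firstMin_le (fun j => r (D j)) i)
    refine (measureReal_mono hsub).trans_eq ?_
    simp [π, measureReal_def, Measure.pi_pi]
  rw [Real.dist_eq, heq n]
  have hsubc : ∫ D, η (D (firstMin fun j => r (D j))) ∂π - c =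
      ∫ D, (η (D (firstMin fun j => r (D j))) - c) ∂π := by
    rw [integral_sub (hint n) (integrable_const _)]
    simp [π]
  calc |∫ D, η (D (firstMin fun j => r (D j))) ∂π - c|
      ≤ ∫ D, |η (D (firstMin fun j => r (D j))) - c| ∂π := by
        rw [hsubc]
        exact abs_integral_le_integral_abs
    _ ≤ ∫ D, (δ / 2 + {D : Fin (n + 1) → α |
          s ≤ r (D (firstMin fun j => r (D j)))}.indicator (fun _ => (1 : ℝ)) D) ∂π := by
        refine integral_mono ((hint n).sub (integrable_const _)).abs
          ((integrable_const _).add ((integrable_const _).indicator hS)) fun D => ?_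
        by_cases hD : s ≤ r (D (firstMin fun j => r (D j)))
        · have h0 := hη0 (D (firstMin fun j => r (D j)))
          have h1 := hη1 (D (firstMin fun j => r (D j)))
          simp only [Set.indicator_apply, Set.mem_ofPred_eq, hD, if_true]
          rw [abs_le]
          constructor <;> linarith [hc.1, hc.2]
        · simp only [Set.indicator_apply, Set.mem_ofPred_eq, hD, if_false, add_zero]
          exact hsδ _ (not_le.1 hD)
    _ = δ / 2 + π.real {D : Fin (n + 1) → α | s ≤ r (D (firstMin fun j => r (D j)))} := by
        rw [integral_add (integrable_const _) ((integrable_const _).indicator hS),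
          integral_indicator_const _ hS]
        simp
    _ < δ := by linarith [hN n hn]

end NearestNeighbour

end MinorityCollective

/-! ### Likelihood ratios of Gaussians with opposite means -/

namespace MinorityCollective

section Gaussian

theorem map_withDensity_comp {α β : Type*} [MeasurableSpace α] [MeasurableSpace β] (ν : Measure α)
    {T : α → β} (hT : Measurable T) {q : β → ENNReal} (hq : Measurable q) :
    (ν.withDensity fun x => q (T x)).map T = (ν.map T).withDensity q := by
  ext s hs
  rw [Measure.map_apply hT hs, withDensity_apply _ (hT hs), withDensity_apply _ hs,
    setLIntegral_map hs hq hT]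

/-- The squares `(a + m) ^ 2` and `(a - m) ^ 2` differ by `4 * m * a`. Zero variance is admitted,
with both measures the Dirac mass at 0, to cover the zero projection. -/
theorem gaussianReal_neg_eq_withDensity (m : ℝ) (v : NNReal) (h : v = 0 → m = 0) :
    gaussianReal (-m) v =
      (gaussianReal m v).withDensity fun a => ENNReal.ofReal (Real.exp (-2 * (m / v * a))) := by
  by_cases hv : v = 0
  · simp [h hv, hv]
  rw [gaussianReal_of_var_ne_zero _ hv, gaussianReal_of_var_ne_zero _ hv,
    ← withDensity_mul _ (measurable_gaussianPDF m v) (by fun_prop)]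
  congr 1
  ext a
  have hv' : (v : ℝ) ≠ 0 := by exact_mod_cast hv
  rw [Pi.mul_apply, gaussianPDF, gaussianPDF, ← ENNReal.ofReal_mul (gaussianPDFReal_nonneg _ _ _),
    gaussianPDFReal, gaussianPDFReal, mul_assoc _ (Real.exp _) (Real.exp _), ← Real.exp_add]
  congr 3
  field_simp
  ring

/-- The exponential of the sum factors over coordinates, so it suffices to compare the measures on
boxes. -/
theorem pi_gaussianReal_neg {ι : Type*} [Fintype ι] (v : ι → ℝ) :
    (Measure.pi fun i => gaussianReal (-v i) 1) =
      (Measure.pi fun i => gaussianReal (v i) 1).withDensity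
        fun x => ENNReal.ofReal (Real.exp (-2 * ∑ i, v i * x i)) := by
  refine Measure.pi_eq fun s hs => ?_
  have hint : ∀ i, Integrable (fun a => Real.exp (-2 * (v i * a)))
      ((gaussianReal (v i) 1).restrict (s i)) := by
    intro i
    have := (integrable_exp_mul_gaussianReal (μ := v i) (v := 1) (-2 * v i)).restrict (s := s i)
    simpa only [mul_assoc] using this
  have hprod : ∀ x : ι → ℝ, Real.exp (-2 * ∑ i, v i * x i) =
      ∏ i, Real.exp (-2 * (v i * x i)) := by
    intro x
    rw [← Real.exp_sum, Finset.mul_sum]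
  simp only [hprod]
  rw [withDensity_apply _ (MeasurableSet.univ_pi hs), Measure.restrict_pi_pi,
    ← ofReal_integral_eq_lintegral_ofReal (Integrable.fintype_prod_dep hint)
      (ae_of_all _ fun x => by positivity),
    integral_fintype_prod_eq_prod (𝕜 := ℝ) (fun i a => Real.exp (-2 * (v i * a))),
    ENNReal.ofReal_prod_of_nonneg fun i _ => integral_nonneg fun a => (Real.exp_pos _).le]
  refine Finset.prod_congr rfl fun i _ => ?_
  rw [ofReal_integral_eq_lintegral_ofReal (hint i) (ae_of_all _ fun x => by positivity),
    gaussianReal_neg_eq_withDensity _ _ (by simp), withDensity_apply _ (hs i)]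
  simp

variable {d : ℕ}

theorem map_add_stdGaussian (v : EuclideanSpace ℝ (Fin d)) :
    (stdGaussian (EuclideanSpace ℝ (Fin d))).map (fun x => v + x) =
      (Measure.pi fun i => gaussianReal (v i) 1).map (WithLp.toLp 2) := by
  have h : (Measure.pi fun i => gaussianReal (v i) 1) =
      (Measure.pi fun _ : Fin d => gaussianReal 0 1).map fun x i => v i + x i := by
    rw [Measure.pi_map_pi (fun i => by fun_prop)]
    congr 1
    ext1 i
    rw [gaussianReal_map_const_add, zero_add]
  rw [h, ← map_pi_eq_stdGaussian, Measure.map_map (by fun_prop) (by fun_prop),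
    Measure.map_map (by fun_prop) (by fun_prop)]
  rfl

theorem map_neg_add_stdGaussian (v : EuclideanSpace ℝ (Fin d)) :
    (stdGaussian (EuclideanSpace ℝ (Fin d))).map (fun x => -v + x) =
      ((stdGaussian (EuclideanSpace ℝ (Fin d))).map (fun x => v + x)).withDensity
        fun x => ENNReal.ofReal (Real.exp (-2 * inner ℝ v x)) := by
  rw [map_add_stdGaussian, map_add_stdGaussian, ← map_withDensity_comp _ (by fun_prop)
    (by fun_prop)]
  congr 1
  simpa [PiLp.inner_apply, mul_comm] using pi_gaussianReal_neg fun i => v i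

variable {S : Matrix (Fin d) (Fin d) ℝ}

open scoped MatrixOrder in
theorem toEuclideanCLM_sqrt_sqrt (hS : S.PosDef) (x : EuclideanSpace ℝ (Fin d)) :
    Matrix.toEuclideanCLM (𝕜 := ℝ) (CFC.sqrt S) (Matrix.toEuclideanCLM (𝕜 := ℝ) (CFC.sqrt S) x) =
      Matrix.toEuclideanCLM (𝕜 := ℝ) S x := by
  rw [← ContinuousLinearMap.comp_apply, ← ContinuousLinearMap.mul_def, ← map_mul,
    CFC.sqrt_mul_sqrt_self _ hS.posSemidef.nonneg]

theorem toEuclideanCLM_mul_inv (hS : S.PosDef) (x : EuclideanSpace ℝ (Fin d)) :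
    Matrix.toEuclideanCLM (𝕜 := ℝ) S (Matrix.toEuclideanCLM (𝕜 := ℝ) S⁻¹ x) = x := by
  rw [← ContinuousLinearMap.comp_apply, ← ContinuousLinearMap.mul_def, ← map_mul,
    Matrix.mul_nonsing_inv _ ((Matrix.isUnit_iff_isUnit_det _).1 hS.isUnit), map_one]
  rfl

open scoped MatrixOrder in
theorem inner_toEuclideanCLM_sqrt (x y : EuclideanSpace ℝ (Fin d)) :
    inner ℝ (Matrix.toEuclideanCLM (𝕜 := ℝ) (CFC.sqrt S) x) y =
      inner ℝ x (Matrix.toEuclideanCLM (𝕜 := ℝ) (CFC.sqrt S) y) := by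
  have h : IsSelfAdjoint (Matrix.toEuclideanCLM (𝕜 := ℝ) (CFC.sqrt S)) :=
    (CFC.sqrt_nonneg S).isSelfAdjoint.map _
  rw [← ContinuousLinearMap.adjoint_inner_right, h.adjoint_eq]

open scoped MatrixOrder in
-- The measure is the image of a standard Gaussian under a continuous affine map, surjective because
-- `S` is invertible. This ensures that samples fall arbitrarily near every query.
theorem isOpenPosMeasure_multivariateGaussian (hS : S.PosDef) (m : EuclideanSpace ℝ (Fin d)) :
    (multivariateGaussian m S).IsOpenPosMeasure := by
  have h1 : (gaussianReal 0 1).IsOpenPosMeasure :=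
    (gaussianReal_absolutelyContinuous' 0 one_ne_zero).isOpenPosMeasure
  have h2 : (stdGaussian (EuclideanSpace ℝ (Fin d))).IsOpenPosMeasure := by
    rw [← map_pi_eq_stdGaussian]
    exact (PiLp.continuous_toLp 2 _).isOpenPosMeasure_map (WithLp.toLp_surjective 2)
  refine Continuous.isOpenPosMeasure_map (by fun_prop) fun y => ?_
  refine ⟨Matrix.toEuclideanCLM (𝕜 := ℝ) (CFC.sqrt S)
    (Matrix.toEuclideanCLM (𝕜 := ℝ) S⁻¹ (y - m)), ?_⟩
  simp only [toEuclideanCLM_sqrt_sqrt hS, toEuclideanCLM_mul_inv hS]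
  abel

open scoped MatrixOrder in
/-- The likelihood ratio of `N(-m, S)` and `N(m, S)`. -/
theorem multivariateGaussian_neg_eq_withDensity (hS : S.PosDef) (m : EuclideanSpace ℝ (Fin d)) :
    multivariateGaussian (-m) S = (multivariateGaussian m S).withDensity fun x =>
      ENNReal.ofReal (Real.exp (-2 * inner ℝ (Matrix.toEuclideanCLM (𝕜 := ℝ) S⁻¹ m) x)) := by
  -- With `T` the square root of `S` and `w = S⁻¹ m`, `N(±m, S)` is the image under `T` of `N(±T w,
  -- I)`. Self-adjointness turns the standard ratio's `⟪T w, x⟫` into `⟪w, T x⟫`, a function of `T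
  -- x`, so the density passes to the image.
  set T := Matrix.toEuclideanCLM (𝕜 := ℝ) (CFC.sqrt S) with hT
  set w := Matrix.toEuclideanCLM (𝕜 := ℝ) S⁻¹ m with hw
  have hTm : T (T w) = m := by rw [hT, toEuclideanCLM_sqrt_sqrt hS, hw, toEuclideanCLM_mul_inv hS]
  have hplus : multivariateGaussian m S =
      ((stdGaussian (EuclideanSpace ℝ (Fin d))).map fun x => T w + x).map T := by
    rw [Measure.map_map (by fun_prop) (by fun_prop), multivariateGaussian]
    congr 1
    ext1 x
    simp [hTm]
    rfl
  have hminus : multivariateGaussian (-m) S =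
      ((stdGaussian (EuclideanSpace ℝ (Fin d))).map fun x => -T w + x).map T := by
    rw [Measure.map_map (by fun_prop) (by fun_prop), multivariateGaussian]
    congr 1
    ext1 x
    simp [hTm]
    rfl
  have hin : ∀ x, inner ℝ (T w) x = inner ℝ w (T x) := inner_toEuclideanCLM_sqrt w
  rw [hplus, hminus, map_neg_add_stdGaussian]
  simp_rw [hin]
  exact map_withDensity_comp _ T.continuous.measurable
    (q := fun x => ENNReal.ofReal (Real.exp (-2 * inner ℝ w x))) (by fun_prop)

theorem map_inner_multivariateGaussian (hS : S.PosDef) (m u : EuclideanSpace ℝ (Fin d)) :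
    (multivariateGaussian m S).map (fun x => inner ℝ u x) =
      gaussianReal (inner ℝ u m) (dotProduct u.ofLp (S.mulVec u.ofLp)).toNNReal := by
  have h := IsGaussian.map_eq_gaussianReal (μ := multivariateGaussian m S) (innerSL ℝ u)
  have hfun : (fun x => inner ℝ u x) = ⇑(innerSL ℝ u) := by ext x; simp
  have hmean : ∫ x, innerSL ℝ u x ∂(multivariateGaussian m S) = inner ℝ u m := by
    have := (innerSL ℝ u).integral_comp_id_comm (μ := multivariateGaussian m S)
      IsGaussian.integrable_id
    rw [integral_id_multivariateGaussian] at this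
    exact this
  rw [hfun, h, hmean]
  congr 2
  rw [← covarianceBilin_multivariateGaussian (μ := m) hS.posSemidef,
    covarianceBilin_self IsGaussian.memLp_two_id]
  rfl

theorem multivariateGaussian_one (m : EuclideanSpace ℝ (Fin d)) :
    multivariateGaussian m 1 = (stdGaussian (EuclideanSpace ℝ (Fin d))).map fun x => m + x := by
  simp [multivariateGaussian]

theorem map_neg_stdGaussian :
    (stdGaussian (EuclideanSpace ℝ (Fin d))).map (fun x => -x) =
      stdGaussian (EuclideanSpace ℝ (Fin d)) :=
  stdGaussian_map (LinearIsometryEquiv.neg ℝ)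

theorem map_neg_multivariateGaussian_one (m : EuclideanSpace ℝ (Fin d)) :
    (multivariateGaussian m 1).map (fun x => -x) = multivariateGaussian (-m) 1 := by
  have h : (stdGaussian (EuclideanSpace ℝ (Fin d))).map (fun x => -m + x) =
      ((stdGaussian (EuclideanSpace ℝ (Fin d))).map (fun x => -x)).map (fun x => -m + x) := by
    rw [map_neg_stdGaussian]
  rw [multivariateGaussian_one, multivariateGaussian_one, h,
    Measure.map_map (by fun_prop) (by fun_prop), Measure.map_map (by fun_prop) (by fun_prop)]
  congr 1
  ext1 x
  simp [add_comm]

end Gaussian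

end MinorityCollective

/-! ### The limiting label error -/

namespace MinorityCollective

section LabelError

variable {d : ℕ} {μ μmin : EuclideanSpace ℝ (Fin d)} {S Smin P : Matrix (Fin d) (Fin d) ℝ}

instance (m : EuclideanSpace ℝ (Fin d)) (S : Matrix (Fin d) (Fin d) ℝ) :
    IsProbabilityMeasure (labelledGaussian m S) := by
  have h1 : IsProbabilityMeasure
      ((multivariateGaussian m S).map fun x : EuclideanSpace ℝ (Fin d) => (x, true)) :=
    Measure.isProbabilityMeasure_map (by fun_prop)
  have h2 : IsProbabilityMeasure
      ((multivariateGaussian (-m) S).map fun x : EuclideanSpace ℝ (Fin d) => (x, false)) :=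
    Measure.isProbabilityMeasure_map (by fun_prop)
  constructor
  rw [labelledGaussian, Measure.add_apply, Measure.smul_apply, Measure.smul_apply, measure_univ,
    measure_univ]
  simp [ENNReal.inv_two_add_inv_two]

theorem nnLabel_eq {n : ℕ} (P : Matrix (Fin d) (Fin d) ℝ)
    (D : Fin (n + 1) → EuclideanSpace ℝ (Fin d) × Bool) (x : EuclideanSpace ℝ (Fin d)) :
    nnLabel P D x = (D (firstMin fun i => repDist P (D i).1 x)).2 := rfl

theorem continuous_repDist {α : Type*} [TopologicalSpace α] (P : Matrix (Fin d) (Fin d) ℝ)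
    {f g : α → EuclideanSpace ℝ (Fin d)} (hf : Continuous f) (hg : Continuous g) :
    Continuous fun a => repDist P (f a) (g a) := by
  unfold repDist
  fun_prop

theorem measurable_repDist {α : Type*} [MeasurableSpace α] (P : Matrix (Fin d) (Fin d) ℝ)
    {f g : α → EuclideanSpace ℝ (Fin d)} (hf : Measurable f) (hg : Measurable g) :
    Measurable fun a => repDist P (f a) (g a) := by
  unfold repDist
  fun_prop

theorem measurable_repDist_fst (P : Matrix (Fin d) (Fin d) ℝ) (x : EuclideanSpace ℝ (Fin d)) :
    Measurable fun z : EuclideanSpace ℝ (Fin d) × Bool => repDist P z.1 x :=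
  measurable_repDist P measurable_fst measurable_const

theorem measurable_nnLabel {n : ℕ} (P : Matrix (Fin d) (Fin d) ℝ) :
    Measurable fun p : (Fin (n + 1) → EuclideanSpace ℝ (Fin d) × Bool) ×
      EuclideanSpace ℝ (Fin d) => nnLabel P p.1 p.2 := by
  have h1 : Measurable fun p : (Fin (n + 1) → EuclideanSpace ℝ (Fin d) × Bool) ×
      EuclideanSpace ℝ (Fin d) => firstMin fun i => repDist P (p.1 i).1 p.2 := by
    refine measurable_firstMin.comp (measurable_pi_lambda _ fun i => ?_)
    exact measurable_repDist P (by fun_prop) (by fun_prop)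
  have h2 : Measurable fun p : Fin (n + 1) × (Fin (n + 1) → EuclideanSpace ℝ (Fin d) × Bool) =>
      (p.2 p.1).2 :=
    measurable_from_prod_countable_right fun i => (measurable_pi_apply i).snd
  exact h2.comp (h1.prodMk measurable_fst)

/-- The label error of 1-NN converges to the error of a random label drawn from the conditional
label law `η` of the majority points given their representation. -/
theorem tendsto_labelError {η : EuclideanSpace ℝ (Fin d) → ℝ} (hη : Measurable η)
    (hη0 : ∀ x, 0 ≤ η x) (hη1 : ∀ x, η x ≤ 1)
    (hdis : ∀ x, ∀ B : Set ℝ, MeasurableSet B →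
      labelledGaussian μ S ((fun z => repDist P z.1 x) ⁻¹' B ∩ {z | z.2 = true}) =
        ∫⁻ z in (fun z => repDist P z.1 x) ⁻¹' B, ENNReal.ofReal (η z.1) ∂(labelledGaussian μ S))
    (hcont : ∀ x, ∀ δ > 0, ∃ s > 0, ∀ z, repDist P z x < s → |η z - η x| ≤ δ)
    (hpos : ∀ x, ∀ s > 0, 0 < labelledGaussian μ S {z | repDist P z.1 x < s}) :
    Tendsto (labelError μ S μmin Smin P) atTop
      (𝓝 (∫ ω, (if ω.2 = true then 1 - η ω.1 else η ω.1) ∂(labelledGaussian μmin Smin))) := by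
  have hmeas : ∀ n : ℕ, MeasurableSet {ω : (Fin (n + 1) → EuclideanSpace ℝ (Fin d) × Bool) ×
      EuclideanSpace ℝ (Fin d) × Bool | nnLabel P ω.1 ω.2.1 ≠ ω.2.2} := by
    intro n
    have h1 : Measurable fun ω : (Fin (n + 1) → EuclideanSpace ℝ (Fin d) × Bool) ×
        EuclideanSpace ℝ (Fin d) × Bool => nnLabel P ω.1 ω.2.1 :=
      (measurable_nnLabel P).comp (measurable_fst.prodMk measurable_snd.fst)
    exact (measurableSet_eq_fun h1 measurable_snd.snd).compl
  have hL : MeasurableSet {z : EuclideanSpace ℝ (Fin d) × Bool | z.2 = true} :=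
    measurable_snd (measurableSet_singleton true)
  -- Fubini freezes the minority point; the limit is then taken pointwise, with dominating function
  -- 1.
  have heq : ∀ n : ℕ, labelError μ S μmin Smin P n = ∫ ω,
      (Measure.pi fun _ : Fin (n + 1) => labelledGaussian μ S).real
        {D | nnLabel P D ω.1 ≠ ω.2} ∂(labelledGaussian μmin Smin) := by
    intro n
    rw [labelError, measureReal_def, Measure.prod_apply_symm (hmeas n),
      ← integral_toReal (measurable_measure_prodMk_right (hmeas n)).aemeasurable
        (ae_of_all _ fun _ => measure_lt_top _ _)]
    rfl
  have hfun : labelError μ S μmin Smin P = fun n => ∫ ω,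
      (Measure.pi fun _ : Fin (n + 1) => labelledGaussian μ S).real
        {D | nnLabel P D ω.1 ≠ ω.2} ∂(labelledGaussian μmin Smin) := funext heq
  rw [hfun]
  refine tendsto_integral_of_dominated_convergence (fun _ => 1)
    (fun n => (measurable_measure_prodMk_right (hmeas n)).ennreal_toReal.aestronglyMeasurable)
    (integrable_const _) (fun n => ae_of_all _ fun ω => ?_) (ae_of_all _ fun ω => ?_)
  · rw [Real.norm_of_nonneg measureReal_nonneg]
    exact measureReal_le_one
  obtain ⟨x, y⟩ := ω
  have hlim := tendsto_measure_nearest_mem (measurable_repDist_fst P x) hL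
    (hη.comp measurable_fst) (fun z => hη0 z.1) (fun z => hη1 z.1) (hdis x) ⟨hη0 x, hη1 x⟩
    (fun δ hδ => by
      obtain ⟨s, hs, h⟩ := hcont x δ hδ
      exact ⟨s, hs, fun z => h z.1⟩) (hpos x)
  cases y
  · simpa [nnLabel_eq] using hlim
  · have hset : ∀ n : ℕ, (Measure.pi fun _ : Fin (n + 1) => labelledGaussian μ S).real
        {D | nnLabel P D x ≠ true} = 1 - (Measure.pi fun _ : Fin (n + 1) =>
          labelledGaussian μ S).real {D | nnLabel P D x = true} := by
      intro n
      have hm : MeasurableSet {D : Fin (n + 1) → EuclideanSpace ℝ (Fin d) × Bool |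
          nnLabel P D x = true} :=
        (measurable_nnLabel P).comp (measurable_id.prodMk measurable_const)
          (measurableSet_singleton true)
      rw [← probReal_compl_eq_one_sub hm]
      rfl
    simp only [hset, if_true]
    exact hlim.const_sub 1

theorem lintegral_labelledGaussian {f : EuclideanSpace ℝ (Fin d) × Bool → ENNReal}
    (hf : Measurable f) : ∫⁻ z, f z ∂(labelledGaussian μ S) =
      2⁻¹ * ∫⁻ x, f (x, true) ∂(multivariateGaussian μ S) +
        2⁻¹ * ∫⁻ x, f (x, false) ∂(multivariateGaussian (-μ) S) := by
  rw [labelledGaussian, lintegral_add_measure, lintegral_smul_measure, lintegral_smul_measure,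
    lintegral_map hf (by fun_prop), lintegral_map hf (by fun_prop)]
  rfl

theorem labelledGaussian_apply {s : Set (EuclideanSpace ℝ (Fin d) × Bool)}
    (hs : MeasurableSet s) : labelledGaussian μ S s =
      2⁻¹ * multivariateGaussian μ S {x | (x, true) ∈ s} +
        2⁻¹ * multivariateGaussian (-μ) S {x | (x, false) ∈ s} := by
  rw [labelledGaussian, Measure.add_apply, Measure.smul_apply, Measure.smul_apply,
    Measure.map_apply (by fun_prop) hs, Measure.map_apply (by fun_prop) hs]
  rfl

/-- If the representation `φ` has likelihood ratio `exp (2 ℓ)`, then `sigmoid (2 ℓ)` is the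
conditional label law given the representation. -/
theorem labelledGaussian_inter_true {F : Type*} [MeasurableSpace F]
    {φ : EuclideanSpace ℝ (Fin d) → F} (hφ : Measurable φ) {ℓ : F → ℝ} (hℓ : Measurable ℓ)
    (hLR : (multivariateGaussian (-μ) S).map φ = ((multivariateGaussian μ S).map φ).withDensity
      fun a => ENNReal.ofReal (Real.exp (-2 * ℓ a)))
    {A : Set F} (hA : MeasurableSet A) :
    labelledGaussian μ S ((fun z => φ z.1) ⁻¹' A ∩ {z | z.2 = true}) =
      ∫⁻ z in (fun z => φ z.1) ⁻¹' A, ENNReal.ofReal (Real.sigmoid (2 * ℓ (φ z.1)))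
        ∂(labelledGaussian μ S) := by
  have hσ : Measurable fun a => ENNReal.ofReal (Real.sigmoid (2 * ℓ a)) :=
    (continuous_sigmoid.measurable.comp (hℓ.const_mul 2)).ennreal_ofReal
  have hA' : MeasurableSet ((fun z : EuclideanSpace ℝ (Fin d) × Bool => φ z.1) ⁻¹' A) :=
    (hφ.comp measurable_fst) hA
  have hL : MeasurableSet {z : EuclideanSpace ℝ (Fin d) × Bool | z.2 = true} :=
    measurable_snd (measurableSet_singleton true)
  have hm : Measurable (((fun z : EuclideanSpace ℝ (Fin d) × Bool => φ z.1) ⁻¹' A).indicator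
      fun z => ENNReal.ofReal (Real.sigmoid (2 * ℓ (φ z.1)))) :=
    (hσ.comp (hφ.comp measurable_fst)).indicator hA'
  have hE : Measurable fun a => ENNReal.ofReal (Real.exp (-2 * ℓ a)) := by fun_prop
  have hmap : ∀ ν : Measure (EuclideanSpace ℝ (Fin d)),
      ∫⁻ x, A.indicator (fun a => ENNReal.ofReal (Real.sigmoid (2 * ℓ a))) (φ x) ∂ν =
        ∫⁻ a in A, ENNReal.ofReal (Real.sigmoid (2 * ℓ a)) ∂(ν.map φ) := by
    intro ν
    rw [← lintegral_indicator hA, lintegral_map (hσ.indicator hA) hφ]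
  rw [← lintegral_indicator hA', labelledGaussian_apply (hA'.inter hL),
    lintegral_labelledGaussian hm]
  change _ = 2⁻¹ * ∫⁻ x, A.indicator (fun a => ENNReal.ofReal (Real.sigmoid (2 * ℓ a))) (φ x)
    ∂(multivariateGaussian μ S) + 2⁻¹ * ∫⁻ x, A.indicator
      (fun a => ENNReal.ofReal (Real.sigmoid (2 * ℓ a))) (φ x) ∂(multivariateGaussian (-μ) S)
  rw [hmap, hmap, hLR, setLIntegral_withDensity_eq_setLIntegral_mul _ hE hσ hA, ← mul_add,
    ← mul_add, ← lintegral_add_left hσ]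
  -- This is `sigmoid t * (1 + exp (-t)) = 1`: the two classes together contribute half the `N(μ,
  -- S)`-mass of the event, which is the mass of its `true` part.
  have hone : ∀ a, ENNReal.ofReal (Real.sigmoid (2 * ℓ a)) +
      ((fun a => ENNReal.ofReal (Real.exp (-2 * ℓ a))) * fun a =>
        ENNReal.ofReal (Real.sigmoid (2 * ℓ a))) a = 1 := by
    intro a
    rw [Pi.mul_apply, ← ENNReal.ofReal_mul (Real.exp_pos _).le, mul_comm (Real.exp _), neg_mul,
      Real.sigmoid_mul_rexp_neg, Real.sigmoid_neg,
      ← ENNReal.ofReal_add (Real.sigmoid_nonneg _) (sub_nonneg.2 (Real.sigmoid_le_one _))]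
    simp
  simp only [hone, lintegral_one, Measure.restrict_apply MeasurableSet.univ, Set.univ_inter,
    Measure.map_apply hφ hA]
  simp
  rfl

/-- The limit of the label error when the log-likelihood ratio of the representation is the linear
function `2 ⟪w, x⟫`. -/
theorem tendsto_labelError_of_likelihoodRatio (hS : S.PosDef) {F : Type*} [MeasurableSpace F]
    {φ : EuclideanSpace ℝ (Fin d) → F} (hφ : Measurable φ) {ℓ : F → ℝ} (hℓ : Measurable ℓ)
    (hLR : (multivariateGaussian (-μ) S).map φ = ((multivariateGaussian μ S).map φ).withDensity
      fun a => ENNReal.ofReal (Real.exp (-2 * ℓ a)))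
    {w : EuclideanSpace ℝ (Fin d)} (hw : ∀ z, ℓ (φ z) = inner ℝ w z)
    (hP : ∀ x, ∃ h : F → ℝ, Measurable h ∧ ∀ z, repDist P z x = h (φ z))
    {K : ℝ} (hK : ∀ z x, |inner ℝ w z - inner ℝ w x| ≤ K * repDist P z x) :
    Tendsto (labelError μ S μmin 1 P) atTop
      (𝓝 (∫ x, Real.sigmoid (-(2 * inner ℝ w x)) ∂(multivariateGaussian μmin 1))) := by
  have hηm : Continuous fun x : EuclideanSpace ℝ (Fin d) => Real.sigmoid (2 * inner ℝ w x) :=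
    continuous_sigmoid.comp (by fun_prop)
  have hint : ∀ (m : EuclideanSpace ℝ (Fin d)) (f : EuclideanSpace ℝ (Fin d) → ℝ), Continuous f →
      (∀ x, 0 ≤ f x) → (∀ x, f x ≤ 1) → Integrable f (multivariateGaussian m 1) := by
    intro m f hf h0 h1
    refine Integrable.of_bound hf.aestronglyMeasurable 1 (ae_of_all _ fun x => ?_)
    rw [Real.norm_of_nonneg (h0 x)]
    exact h1 x
  have hlim := tendsto_labelError (μ := μ) (S := S) (P := P) (μmin := μmin) (Smin := 1)
    hηm.measurable (fun x => Real.sigmoid_nonneg _) (fun x => Real.sigmoid_le_one _) ?_ ?_ ?_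
  · convert hlim using 2
    set f : EuclideanSpace ℝ (Fin d) × Bool → ℝ := fun ω =>
      if ω.2 = true then 1 - Real.sigmoid (2 * inner ℝ w ω.1) else Real.sigmoid (2 * inner ℝ w ω.1)
    have hf : Measurable f :=
      Measurable.ite (measurable_snd (measurableSet_singleton true))
        ((hηm.measurable.comp measurable_fst).const_sub 1) (hηm.measurable.comp measurable_fst)
    have hfi : ∀ ν : Measure (EuclideanSpace ℝ (Fin d) × Bool), IsFiniteMeasure ν →
        Integrable f ν := by
      intro ν hν
      refine Integrable.of_bound hf.aestronglyMeasurable 1 (ae_of_all _ fun z => ?_)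
      have h0 := Real.sigmoid_nonneg (2 * inner ℝ w z.1)
      have h1 := Real.sigmoid_le_one (2 * inner ℝ w z.1)
      rw [Real.norm_eq_abs, abs_le]
      simp only [f]
      split_ifs <;> constructor <;> linarith
    -- Reflection carries the `false` class to the `true` one, so both contribute the same error.
    have hneg : ∫ x, Real.sigmoid (2 * inner ℝ w x) ∂(multivariateGaussian (-μmin) 1) =
        ∫ x, Real.sigmoid (-(2 * inner ℝ w x)) ∂(multivariateGaussian μmin 1) := by
      rw [← map_neg_multivariateGaussian_one,
        integral_map (by fun_prop) hηm.aestronglyMeasurable]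
      simp
    rw [labelledGaussian, integral_add_measure ((hfi _ inferInstance).smul_measure (by simp))
      ((hfi _ inferInstance).smul_measure (by simp)), integral_smul_measure, integral_smul_measure,
      integral_map (by fun_prop) hf.aestronglyMeasurable,
      integral_map (by fun_prop) hf.aestronglyMeasurable]
    simp only [f, if_true, Bool.false_eq_true, if_false]
    rw [hneg]
    simp only [← Real.sigmoid_neg]
    rw [← add_smul]
    norm_num
  · intro x B hB
    obtain ⟨h, hh, hhP⟩ := hP x
    have := labelledGaussian_inter_true hφ hℓ hLR (hh hB)
    simp only [hw] at this
    simp only [hhP]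
    exact this
  · intro x δ hδ
    obtain ⟨t, ht, h⟩ := Metric.continuous_iff.1 continuous_sigmoid (2 * inner ℝ w x) δ hδ
    -- The sigmoid's argument varies at most `2 * |K|` times as fast as the representation; adding 1
    -- avoids division by zero.
    refine ⟨t / (2 * |K| + 1), by positivity, fun z hz => (h _ ?_).le⟩
    have h0 : 0 ≤ repDist P z x := dist_nonneg
    rw [lt_div_iff₀ (by positivity)] at hz
    have h1 := hK z x
    have h2 := mul_le_mul_of_nonneg_right (le_abs_self K) h0
    rw [Real.dist_eq, ← mul_sub, abs_mul, abs_two]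
    nlinarith
  · intro x s hs
    have := isOpenPosMeasure_multivariateGaussian hS μ
    have ho : IsOpen {z | repDist P z x < s} :=
      isOpen_lt (continuous_repDist P continuous_id continuous_const) continuous_const
    have hpos : 0 < multivariateGaussian μ S {z | repDist P z x < s} :=
      ho.measure_pos _ ⟨x, by simpa [repDist] using hs⟩
    rw [labelledGaussian_apply (measurableSet_lt (measurable_repDist_fst P x) measurable_const)]
    exact lt_of_lt_of_le (ENNReal.mul_pos (by simp) hpos.ne') le_self_add

theorem continuous_sigmoid_inner (w m : EuclideanSpace ℝ (Fin d)) :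
    Continuous fun x => Real.sigmoid (-(2 * inner ℝ w (m + x))) :=
  continuous_sigmoid.comp (by fun_prop)

theorem integrable_sigmoid_inner (w m v : EuclideanSpace ℝ (Fin d)) :
    Integrable (fun x => Real.sigmoid (-(2 * inner ℝ w (m + x)))) (multivariateGaussian v 1) := by
  refine Integrable.of_bound (continuous_sigmoid_inner w m).aestronglyMeasurable 1
    (ae_of_all _ fun x => ?_)
  rw [Real.norm_of_nonneg (Real.sigmoid_nonneg _)]
  exact Real.sigmoid_le_one _

theorem integral_sigmoid_inner_eq (w m : EuclideanSpace ℝ (Fin d)) :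
    ∫ x, Real.sigmoid (-(2 * inner ℝ w x)) ∂(multivariateGaussian m 1) =
      ∫ x, Real.sigmoid (-(2 * inner ℝ w (m + x))) ∂(multivariateGaussian 0 1) := by
  have h := continuous_sigmoid_inner w 0
  simp only [zero_add] at h
  rw [multivariateGaussian_one, integral_map (by fun_prop) h.aestronglyMeasurable,
    multivariateGaussian_zero_one]

/-- Reflecting `x` turns the integrand into one minus itself, so the integral `I` satisfies `I = 1 -
I`. -/
theorem integral_sigmoid_inner_zero (w : EuclideanSpace ℝ (Fin d)) :
    ∫ x, Real.sigmoid (-(2 * inner ℝ w (0 + x))) ∂(multivariateGaussian 0 1) = 1 / 2 := by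
  have h1 : ∫ x, Real.sigmoid (-(2 * inner ℝ w (0 + x))) ∂(multivariateGaussian 0 1) =
      ∫ x, (1 - Real.sigmoid (-(2 * inner ℝ w (0 + x)))) ∂(multivariateGaussian 0 1) := by
    have h := map_neg_multivariateGaussian_one (0 : EuclideanSpace ℝ (Fin d))
    rw [neg_zero] at h
    nth_rewrite 1 [← h]
    rw [integral_map (by fun_prop) (continuous_sigmoid_inner w 0).aestronglyMeasurable]
    simp [← Real.sigmoid_neg]
  rw [integral_sub (integrable_const _) (integrable_sigmoid_inner w 0 0)] at h1
  simp only [integral_const, probReal_univ, one_smul] at h1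
  linarith

theorem integral_lt_integral_of_lt {Ω : Type*} [MeasurableSpace Ω] {ν : Measure Ω}
    [IsProbabilityMeasure ν] {f g : Ω → ℝ} (hf : Integrable f ν) (hg : Integrable g ν)
    (h : ∀ x, f x < g x) : ∫ x, f x ∂ν < ∫ x, g x ∂ν := by
  rw [← sub_pos, ← integral_sub hg hf, integral_pos_iff_support_of_nonneg
    (fun x => sub_nonneg.2 (h x).le) (hg.sub hf)]
  have : Function.support (fun x => g x - f x) = Set.univ := by
    ext x
    simpa using (sub_pos.2 (h x)).ne'
  simp [this]

/-- Centring the Gaussian moves `m` into the argument, which is then strictly smaller at every point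
than in the symmetric case. -/
theorem integral_sigmoid_inner_lt {w m : EuclideanSpace ℝ (Fin d)} (h : 0 < inner ℝ w m) :
    ∫ x, Real.sigmoid (-(2 * inner ℝ w x)) ∂(multivariateGaussian m 1) < 1 / 2 := by
  rw [integral_sigmoid_inner_eq, ← integral_sigmoid_inner_zero w]
  refine integral_lt_integral_of_lt (integrable_sigmoid_inner w m 0)
    (integrable_sigmoid_inner w 0 0) fun x => Real.sigmoid_lt ?_
  simp only [inner_add_right, inner_zero_right]
  linarith

theorem lt_integral_sigmoid_inner {w m : EuclideanSpace ℝ (Fin d)} (h : inner ℝ w m < 0) :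
    1 / 2 < ∫ x, Real.sigmoid (-(2 * inner ℝ w x)) ∂(multivariateGaussian m 1) := by
  rw [integral_sigmoid_inner_eq, ← integral_sigmoid_inner_zero w]
  refine integral_lt_integral_of_lt (integrable_sigmoid_inner w 0 0)
    (integrable_sigmoid_inner w m 0) fun x => Real.sigmoid_lt ?_
  simp only [inner_add_right, inner_zero_right]
  linarith

end LabelError

end MinorityCollective

/-! ### Raw features and projections of rank at most one -/

namespace MinorityCollective

section Representations

variable {d : ℕ} {μ μmin : EuclideanSpace ℝ (Fin d)} {S : Matrix (Fin d) (Fin d) ℝ}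

/-- The limit of the label error on the raw features. -/
theorem tendsto_labelError_raw (hS : S.PosDef) :
    Tendsto (labelError μ S μmin 1 1) atTop (𝓝 (∫ x, Real.sigmoid
      (-(2 * inner ℝ (Matrix.toEuclideanCLM (𝕜 := ℝ) S⁻¹ μ) x))
        ∂(multivariateGaussian μmin 1))) := by
  refine tendsto_labelError_of_likelihoodRatio hS (φ := id)
    (ℓ := fun z => inner ℝ (Matrix.toEuclideanCLM (𝕜 := ℝ) S⁻¹ μ) z) measurable_id (by fun_prop)
    ?_ (fun _ => rfl) (fun x => ⟨fun z => repDist 1 z x,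
      measurable_repDist 1 measurable_id measurable_const, fun _ => rfl⟩)
    (K := ‖Matrix.toEuclideanCLM (𝕜 := ℝ) S⁻¹ μ‖) fun z x => ?_
  · rw [Measure.map_id, Measure.map_id]
    exact multivariateGaussian_neg_eq_withDensity hS μ
  · rw [← inner_sub_right, repDist, map_one, dist_eq_norm]
    exact abs_real_inner_le_norm _ _

theorem toEuclideanCLM_vecMulVec (u z : EuclideanSpace ℝ (Fin d)) :
    Matrix.toEuclideanCLM (𝕜 := ℝ) (Matrix.vecMulVec u.ofLp u.ofLp) z = inner ℝ u z • u := by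
  ext i
  rw [Matrix.ofLp_toEuclideanCLM, Matrix.vecMulVec_mulVec]
  simp [PiLp.inner_apply, dotProduct, mul_comm]

theorem repDist_vecMulVec (u z x : EuclideanSpace ℝ (Fin d)) :
    repDist (Matrix.vecMulVec u.ofLp u.ofLp) z x = |inner ℝ u z - inner ℝ u x| * ‖u‖ := by
  rw [repDist, toEuclideanCLM_vecMulVec, toEuclideanCLM_vecMulVec, dist_eq_norm, ← sub_smul,
    norm_smul, Real.norm_eq_abs]

theorem dotProduct_mulVec_pos (hS : S.PosDef) {u : EuclideanSpace ℝ (Fin d)} (hu : u ≠ 0) :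
    0 < dotProduct u.ofLp (S.mulVec u.ofLp) := by
  have h : u.ofLp ≠ 0 := by simpa using hu
  simpa using hS.dotProduct_mulVec_pos h

/-- The limit of the label error on a representation of rank at most one. -/
theorem tendsto_labelError_vecMulVec (hS : S.PosDef) {u : EuclideanSpace ℝ (Fin d)}
    (hu : u = 0 ∨ ‖u‖ = 1) :
    Tendsto (labelError μ S μmin 1 (Matrix.vecMulVec u.ofLp u.ofLp)) atTop
      (𝓝 (∫ x, Real.sigmoid (-(2 * inner ℝ
        ((inner ℝ u μ / ((dotProduct u.ofLp (S.mulVec u.ofLp)).toNNReal : ℝ)) • u) x))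
        ∂(multivariateGaussian μmin 1))) := by
  set v := (dotProduct u.ofLp (S.mulVec u.ofLp)).toNNReal with hv
  refine tendsto_labelError_of_likelihoodRatio hS (φ := fun z => inner ℝ u z)
    (ℓ := fun a => inner ℝ u μ / (v : ℝ) * a) (by fun_prop) (by fun_prop) ?_
    (fun z => by rw [real_inner_smul_left])
    (fun x => ⟨fun a => |a - inner ℝ u x| * ‖u‖, by fun_prop, fun z => repDist_vecMulVec u z x⟩)
    (K := |inner ℝ u μ / (v : ℝ)|) fun z x => ?_
  · rw [map_inner_multivariateGaussian hS, map_inner_multivariateGaussian hS, inner_neg_right]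
    -- Positive definiteness makes the variance vanish only for `u = 0`, where the mean vanishes
    -- too.
    refine gaussianReal_neg_eq_withDensity _ _ fun h0 => ?_
    by_contra hne
    have hu0 : u ≠ 0 := by
      rintro rfl
      simp at hne
    exact (Real.toNNReal_pos.2 (dotProduct_mulVec_pos hS hu0)).ne' h0
  · rw [real_inner_smul_left, real_inner_smul_left, ← mul_sub, abs_mul, repDist_vecMulVec]
    rcases hu with rfl | hu
    · simp
    · rw [hu, mul_one]

theorem vecMulVec_mul_self {u : EuclideanSpace ℝ (Fin d)} (hu : u = 0 ∨ ‖u‖ = 1) :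
    Matrix.vecMulVec u.ofLp u.ofLp * Matrix.vecMulVec u.ofLp u.ofLp =
      Matrix.vecMulVec u.ofLp u.ofLp := by
  rcases hu with rfl | hu
  · simp
  · have h : dotProduct u.ofLp u.ofLp = 1 := by
      have := EuclideanSpace.real_norm_sq_eq u
      rw [hu, one_pow] at this
      rw [this, dotProduct]
      exact Finset.sum_congr rfl fun i _ => (sq _).symm
    rw [Matrix.vecMulVec_mul_vecMulVec, h, one_smul]

/-- Two linearly independent vectors have positive inner products with a common unit vector. -/
theorem exists_unit_inner_pos {E : Type*} [NormedAddCommGroup E] [InnerProductSpace ℝ E] {a b : E}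
    (h : LinearIndependent ℝ ![a, b]) : ∃ u : E, ‖u‖ = 1 ∧ 0 < inner ℝ u a ∧ 0 < inner ℝ u b := by
  have ha : 0 < ‖a‖ := norm_pos_iff.2 (h.ne_zero 0)
  have hb : 0 < ‖b‖ := norm_pos_iff.2 (h.ne_zero 1)
  -- Strict Cauchy–Schwarz: `a` and `b` are not opposite. The bisector `‖b‖ • a + ‖a‖ • b` therefore
  -- has inner product `‖a‖ * (‖a‖ * ‖b‖ + ⟪a, b⟫) > 0` with `a`, and symmetrically with `b`.
  have hab : inner ℝ a (-b) < ‖a‖ * ‖-b‖ := by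
    rw [inner_lt_norm_mul_iff_real]
    intro heq
    have := (LinearIndependent.pair_iff.1 h ‖b‖ ‖a‖ (by
      rw [norm_neg, smul_neg] at heq
      rw [heq, neg_add_cancel])).1
    exact hb.ne' this
  rw [inner_neg_right, norm_neg] at hab
  have hpos : ∀ x : E, 0 < inner ℝ (‖b‖ • a + ‖a‖ • b) x →
      0 < inner ℝ (‖‖b‖ • a + ‖a‖ • b‖⁻¹ • (‖b‖ • a + ‖a‖ • b)) x := by
    intro x hx
    have hne : ‖b‖ • a + ‖a‖ • b ≠ 0 := fun h0 => by simp [h0] at hx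
    rw [real_inner_smul_left]
    exact mul_pos (inv_pos.2 (norm_pos_iff.2 hne)) hx
  have h1 : 0 < inner ℝ (‖b‖ • a + ‖a‖ • b) a := by
    rw [inner_add_left, real_inner_smul_left, real_inner_smul_left, real_inner_self_eq_norm_sq,
      real_inner_comm]
    nlinarith
  have h2 : 0 < inner ℝ (‖b‖ • a + ‖a‖ • b) b := by
    rw [inner_add_left, real_inner_smul_left, real_inner_smul_left, real_inner_self_eq_norm_sq]
    nlinarith
  have hne : ‖b‖ • a + ‖a‖ • b ≠ 0 := fun h0 => by simp [h0] at h1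
  refine ⟨‖‖b‖ • a + ‖a‖ • b‖⁻¹ • (‖b‖ • a + ‖a‖ • b), ?_, hpos a h1, hpos b h2⟩
  rw [norm_smul, norm_inv, norm_norm, inv_mul_cancel₀ (norm_ne_zero_iff.2 hne)]

/-- Some representation of rank at most one has an asymptotic label error of at most `1 / 2`. -/
theorem exists_projection_labelError_le_half (hS : S.PosDef) :
    ∃ P : Matrix (Fin d) (Fin d) ℝ, P * P = P ∧ P.transpose = P ∧ ∃ e : ℝ,
      Tendsto (labelError μ S μmin 1 P) atTop (𝓝 e) ∧ e ≤ 1 / 2 ∧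
      (LinearIndependent ℝ ![μ, μmin] → e < 1 / 2) := by
  by_cases h : LinearIndependent ℝ ![μ, μmin]
  · obtain ⟨u, hu, hμ, hμmin⟩ := exists_unit_inner_pos h
    have hu0 : u ≠ 0 := by
      rintro rfl
      simp at hu
    have hv : (0 : ℝ) < (dotProduct u.ofLp (S.mulVec u.ofLp)).toNNReal :=
      NNReal.coe_pos.2 (Real.toNNReal_pos.2 (dotProduct_mulVec_pos hS hu0))
    have hlt := integral_sigmoid_inner_lt (m := μmin)
      (w := (inner ℝ u μ / ((dotProduct u.ofLp (S.mulVec u.ofLp)).toNNReal : ℝ)) • u) (by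
        rw [real_inner_smul_left]
        exact mul_pos (div_pos hμ hv) hμmin)
    exact ⟨_, vecMulVec_mul_self (Or.inr hu), Matrix.transpose_vecMulVec _ _, _,
      tendsto_labelError_vecMulVec hS (Or.inr hu), hlt.le, fun _ => hlt⟩
  -- The zero projection ties all samples, so the label carries no information on the query: here `w
  -- = 0` and the integrand is `sigmoid 0 = 1 / 2`.
  · refine ⟨_, vecMulVec_mul_self (Or.inl rfl), Matrix.transpose_vecMulVec _ _, _,
      tendsto_labelError_vecMulVec hS (Or.inl rfl), ?_, fun h' => absurd h' h⟩
    norm_num [Real.sigmoid_zero]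

end Representations

end MinorityCollective

/-! ### Combination of the two halves -/

theorem mainTheorem6 (d : ℕ) (μ μmin : EuclideanSpace ℝ (Fin d))
    (S : Matrix (Fin d) (Fin d) ℝ) (hS : S.PosDef)
    (hneg : dotProduct μmin.ofLp (S⁻¹.mulVec μ.ofLp) < 0) :
    ∃ P : Matrix (Fin d) (Fin d) ℝ, P * P = P ∧ P.transpose = P ∧
      ∃ eRep eRaw : ℝ,
        Tendsto (MinorityCollective.labelError μ S μmin 1 P) atTop (𝓝 eRep) ∧
        Tendsto (MinorityCollective.labelError μ S μmin 1 1) atTop (𝓝 eRaw) ∧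
        eRep < eRaw ∧ eRep ≤ 1 / 2 ∧ 1 / 2 < eRaw ∧
        (LinearIndependent ℝ ![μ, μmin] → eRep < 1 / 2) ∧
        -- the success bound with label error, and its comparison for the asymptotic errors
        (∀ (X : Type u) [MeasurableSpace X] (C : MinorityCollective.Collective X) (ε : ℝ), 0 ≤ ε →
          (∀ e ∈ Set.Icc (0 : ℝ) 1, ∀ f : X → Bool, Measurable f →
            MinorityCollective.IsSuboptimal ε Set.univ (C.train e) f →
              C.guarantee ε e ≤ C.success f) ∧
          C.guarantee ε eRaw ≤ C.guarantee ε eRep ∧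
          (2 * (1 - C.α) * C.tau + 2 * ε < (1 - 2 * eRep) * C.α →
            C.guarantee ε eRaw < C.guarantee ε eRep)) ∧
        -- the comparison for the errors of all sufficiently large samples
        (∀ᶠ n : ℕ in atTop,
          MinorityCollective.labelError μ S μmin 1 P n <
            MinorityCollective.labelError μ S μmin 1 1 n ∧
          ∀ (X : Type u) [MeasurableSpace X] (C : MinorityCollective.Collective X) (ε : ℝ), 0 ≤ ε →
            C.guarantee ε (MinorityCollective.labelError μ S μmin 1 1 n) ≤
              C.guarantee ε (MinorityCollective.labelError μ S μmin 1 P n) ∧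
            (2 * (1 - C.α) * C.tau + 2 * ε <
                (1 - 2 * MinorityCollective.labelError μ S μmin 1 P n) * C.α →
              C.guarantee ε (MinorityCollective.labelError μ S μmin 1 1 n) <
                C.guarantee ε (MinorityCollective.labelError μ S μmin 1 P n))) := by
  obtain ⟨P, hPP, hPt, eRep, hRep, hle, hlt⟩ :=
    MinorityCollective.exists_projection_labelError_le_half (μ := μ) (μmin := μmin) hS
  have hRaw := MinorityCollective.tendsto_labelError_raw (μ := μ) (μmin := μmin) hS
  have hhalf := MinorityCollective.lt_integral_sigmoid_inner (m := μmin)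
    (w := Matrix.toEuclideanCLM (𝕜 := ℝ) S⁻¹ μ)
    (by rwa [real_inner_comm, Matrix.inner_toEuclideanCLM])
  have hgap := hle.trans_lt hhalf
  refine ⟨P, hPP, hPt, eRep, _, hRep, hRaw, hgap, hle, hhalf, hlt, ?_, ?_⟩
  · intro X _ C ε hε
    exact ⟨fun e he f hf hsub => C.guarantee_le_success hε he hf hsub,
      C.guarantee_antitone hε hgap.le, C.guarantee_lt_guarantee hε hhalf⟩
  -- Only the order of the two errors and the raw error exceeding `1 / 2` are used. Both hold
  -- eventually by convergence, before any collective is chosen, so the threshold is uniform.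
  · filter_upwards [hRep.eventually_lt hRaw hgap, hRaw.eventually (lt_mem_nhds hhalf)]
      with n hn hn'
    exact ⟨hn, fun X _ C ε hε =>
      ⟨C.guarantee_antitone hε hn.le, C.guarantee_lt_guarantee hε hn'⟩⟩
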